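/- Let $\mathcal{B}_n$ denote the family of all subsets of $[n]=\{1,\dots,n\}$ ordered by inclusion; in particular $\mathcal{B}_2$ is the four-element diamond. A family $\mathcal{F}\subseteq\mathcal{B}_n$ is called $P$-free if the inclusion order on $\mathcal{F}$ contains no induced copy of the poset $P$. Let $\mathrm{La}^*(n,P)$ be the maximum size of a $P$-free family $\mathcal{F}\subseteq\mathcal{B}_n$, and let $\pi^*(P)=\limsup_{n\to\infty}\mathrm{La}^*(n,P)/\binom{n}{\lfloor n/2\rfloor}$. The Lubell mass $\ell(\mathcal{F})$ of $\mathcal{F}\subseteq\mathcal{B}_n$ is the expected number of members of $\mathcal{F}$ on a maximal chain of $\mathcal{B}_n$ chosen uniformly at random, so that $\ell(\mathcal{F})=\sum_{A\in\mathcal{F}}\binom{n}{|A|}^{-1}$. Let $$\rho^*(P)=\limsup_{n\to\infty}\ \max\{\ell(\mathcal{F}) : \emptyset\in\mathcal{F}\subseteq\mathcal{B}_n \text{ and } \mathcal{F}\text{ is } P\text{-free}\}.$$ **Theorem.** $2.2818564<\rho^*(\mathcal{B}_2)<2.5823284$. Moreover $\pi^*(\mathcal{B}_2)\le\rho^*(\mathcal{B}_2)$,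 and consequently $$\mathrm{La}^*(n,\mathcal{B}_2)\le(2.583+o(1))\binom{n}{\lfloor n/2\rfloor}\qquad(n\to\infty).$$ -/

import Mathlib

open Filter Topology

noncomputable section

/-- The `n`-dimensional Boolean lattice: subsets of an `n`-element ground set ordered by
inclusion (on `Finset`, `≤` is `⊆`). -/
abbrev BoolLattice (n : ℕ) : Type := Finset (Fin n)

/-- A family `F` of subsets of an `n`-set is `P`-free if the inclusion order on `F` contains no
induced copy of the poset `P`. -/
def IsPosetFree (P : Type*) [PartialOrder P] {n : ℕ} (F : Finset (BoolLattice n)) : Prop :=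
  IsEmpty (P ↪o {A : BoolLattice n // A ∈ F})

open Classical in
/-- The Turán function `La*(n, P)`: the maximum size of a `P`-free family in the
`n`-dimensional Boolean lattice. -/
def turanLa (n : ℕ) (P : Type*) [PartialOrder P] : ℕ :=
  (Finset.univ.filter fun F : Finset (BoolLattice n) => IsPosetFree P F).sup Finset.card

/-- The Turán threshold `π*(P)`, as an extended real number. -/
def turanThreshold (P : Type*) [PartialOrder P] : EReal :=
  limsup (fun n : ℕ => (((turanLa n P : ℝ) / (n.choose (n / 2) : ℝ) : ℝ) : EReal)) atTop

open Classical in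
/-- The set of all maximal chains of the `n`-dimensional Boolean lattice. -/
def maxChains (n : ℕ) : Finset (Finset (BoolLattice n)) :=
  Finset.univ.filter fun C => IsMaxChain (· ≤ ·) (C : Set (BoolLattice n))

/-- The Lubell mass `ℓ(F)`: the expected number of members of `F` on a maximal chain chosen
uniformly at random. -/
def lubell {n : ℕ} (F : Finset (BoolLattice n)) : ℝ :=
  (∑ C ∈ maxChains n, ((F ∩ C).card : ℝ)) / ((maxChains n).card : ℝ)

/-- `ρ*(P)`: the limsup, as the dimension tends to infinity, of the largest Lubell mass of a
`P`-free family containing the empty set, as an extended real number. -/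
def rhoStar (P : Type*) [PartialOrder P] : EReal :=
  limsup (fun n : ℕ => ⨆ (F : Finset (BoolLattice n)) (_ : ∅ ∈ F ∧ IsPosetFree P F),
    ((lubell F : ℝ) : EReal)) atTop

end

/-! ### Maximal chains and the Lubell mass -/

/-! Upper bound. In a diamond-free family containing `∅`, the members below any member form a chain.
Remove `∅`, call the rest `G`, and let `S` be the set of points whose singletons lie in `G`. The
mass of `G` below `B` is `[B ∈ G]` plus the average of the masses below the sets `B.erase x`
(`downLubell_eq_ite_add`). If `B ∈ G`, the chain condition bounds it directly, with at most one
point of `S` in `B`. If `B ∉ G`, a bound that is preserved by averaging passes from `k`-sets to `(k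
+ 1)`-sets; `chainLowerBound` is such a function of `k` and `s = |B ∩ S|`. With `B` the ground set
and `α = s / k`, it tends to `17/12 + α - 9/4 α² + α³ < 1.5424`; with `∅` added back, 2.57 is a
valid bound for `n ≥ 100`.

Lower bound. Split the ground set into three parts in proportion 3 : 5 : 2 and take all sets whose
intersection sizes with the parts form one of nine triples; the mass tends to 2.284.

Threshold. Condition a random chain on its smallest member `A` of a `P`-free family: the members
above `A` form a `P`-free family with bottom `∅` on `n - |A|` points. After discarding the few very
large sets, the mass is therefore at most any real above `ρ*(P)` (`turanLa_le`), and mass bounds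
size. -/

lemma mem_maxChains {n : ℕ} {C : Finset (BoolLattice n)} :
    C ∈ maxChains n ↔ IsMaxChain (· ≤ ·) (C : Set (BoolLattice n)) := by
  simp [maxChains]

lemma maxChains_nonempty (n : ℕ) : (maxChains n).Nonempty := by
  classical
  refine ⟨(maxChain (α := BoolLattice n) (· ≤ ·)).toFinset, ?_⟩
  rw [mem_maxChains, Set.coe_toFinset]
  exact maxChain_spec

lemma exists_card_eq_of_isMaxChain {n k : ℕ} (hk : k ≤ n) {C : Finset (BoolLattice n)}
    (hC : IsMaxChain (· ≤ ·) (C : Set (BoolLattice n))) : ∃ A ∈ C, A.card = k := by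
  classical
  by_contra! h
  have htot : ∀ A ∈ C, ∀ B ∈ C, A ⊆ B ∨ B ⊆ A := fun A hA B hB => hC.1.total hA hB
  -- If no member has size `k`, a `k`-set between the union of the smaller members and the
  -- intersection of the larger ones extends the chain. The empty union is `∅` and the empty
  -- intersection is the whole ground set.
  set U := (C.filter fun A => A.card < k).sup id with hU
  set V := (C.filter fun A => k < A.card).inf id with hV
  have hUk : U.card ≤ k := by
    have : U = ∅ ∨ (U ∈ C ∧ U.card < k) := by
      refine Finset.sup_induction (p := fun X => X = ∅ ∨ (X ∈ C ∧ X.card < k)) (Or.inl rfl) ?_ ?_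
      · rintro X (rfl | hX) Y (rfl | hY)
        · simp
        · simpa using Or.inr hY
        · simpa using Or.inr hX
        · rcases htot X hX.1 Y hY.1 with h' | h'
          · rw [sup_eq_right.2 h']; exact Or.inr hY
          · rw [sup_eq_left.2 h']; exact Or.inr hX
      · intro X hX
        exact Or.inr (by simpa using hX)
    rcases this with h' | h'
    · simp [h']
    · exact h'.2.le
  have hVk : k ≤ V.card := by
    have : V = Finset.univ ∨ (V ∈ C ∧ k < V.card) := by
      refine Finset.inf_induction (p := fun X => X = Finset.univ ∨ (X ∈ C ∧ k < X.card))
        (Or.inl rfl) ?_ ?_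
      · rintro X (rfl | hX) Y (rfl | hY)
        · simp
        · simpa using Or.inr hY
        · simpa using Or.inr hX
        · rcases htot X hX.1 Y hY.1 with h' | h'
          · rw [inf_eq_left.2 h']; exact Or.inr hX
          · rw [inf_eq_right.2 h']; exact Or.inr hY
      · intro X hX
        exact Or.inr (by simpa using hX)
    rcases this with h' | h'
    · simpa [h'] using hk
    · exact h'.2.le
  have hUV : U ⊆ V := by
    refine Finset.sup_le fun X hX => Finset.le_inf fun Y hY => ?_
    simp only [Finset.mem_filter] at hX hY
    rcases htot X hX.1 Y hY.1 with h' | h'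
    · exact h'
    · have := Finset.card_le_card h'
      omega
  obtain ⟨X, hUX, hXV, hXk⟩ := Finset.exists_subsuperset_card_eq hUV hUk hVk
  refine h X ?_ hXk
  have hins : IsChain (· ≤ ·) (insert X (C : Set (BoolLattice n))) := by
    refine hC.1.insert fun B hB _ => ?_
    rcases lt_trichotomy B.card k with hlt | heq | hgt
    · exact Or.inr ((Finset.le_sup (f := id) (Finset.mem_filter.2 ⟨hB, hlt⟩)).trans hUX)
    · exact absurd heq (h B hB)
    · exact Or.inl (le_trans hXV (Finset.inf_le (f := id) (Finset.mem_filter.2 ⟨hB, hgt⟩)))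
  have := hC.2 hins (Set.subset_insert _ _)
  have hX : X ∈ (C : Set (BoolLattice n)) := by rw [this]; exact Set.mem_insert _ _
  exact hX

lemma card_filter_card_eq_of_isMaxChain {n k : ℕ} (hk : k ≤ n) {C : Finset (BoolLattice n)}
    (hC : IsMaxChain (· ≤ ·) (C : Set (BoolLattice n))) :
    (C.filter fun A => A.card = k).card = 1 := by
  obtain ⟨A, hA, hAk⟩ := exists_card_eq_of_isMaxChain hk hC
  rw [Finset.card_eq_one]
  refine ⟨A, ?_⟩
  ext B
  simp only [Finset.mem_filter, Finset.mem_singleton]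
  constructor
  · rintro ⟨hB, hBk⟩
    rcases hC.1.total hA hB with h | h
    · exact (Finset.eq_of_subset_of_card_le h (by omega)).symm
    · exact Finset.eq_of_subset_of_card_le h (by omega)
  · rintro rfl
    exact ⟨hA, hAk⟩

lemma exists_perm_map_eq {n : ℕ} {A B : BoolLattice n} (h : A.card = B.card) :
    ∃ σ : Equiv.Perm (Fin n), A.map σ.toEmbedding = B := by
  classical
  let e : {x // x ∈ A} ≃ {x // x ∈ B} := Finset.equivOfCardEq h
  refine ⟨e.extendSubtype, ?_⟩
  refine Finset.eq_of_subset_of_card_le ?_ (by simp [h])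
  intro y hy
  obtain ⟨x, hx, rfl⟩ := Finset.mem_map.1 hy
  exact e.extendSubtype_mem x hx

lemma isMaxChain_map_perm {n : ℕ} (σ : Equiv.Perm (Fin n)) {C : Finset (BoolLattice n)}
    (hC : C ∈ maxChains n) :
    C.map (Equiv.finsetCongr σ).toEmbedding ∈ maxChains n := by
  rw [mem_maxChains] at hC ⊢
  let e : BoolLattice n ≃o BoolLattice n :=
    ⟨Equiv.finsetCongr σ, by intro a b; simp [Equiv.finsetCongr]⟩
  rw [Finset.coe_map]
  exact hC.image e

open Classical in
lemma card_maxChains_through_le {n : ℕ} {A B : BoolLattice n} (h : A.card = B.card) :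
    ((maxChains n).filter fun C => A ∈ C).card ≤ ((maxChains n).filter fun C => B ∈ C).card := by
  obtain ⟨σ, rfl⟩ := exists_perm_map_eq h
  refine Finset.card_le_card_of_injOn (fun C => C.map (Equiv.finsetCongr σ).toEmbedding) ?_
    ((Finset.map_injective _).injOn)
  intro C hC
  simp only [Finset.coe_filter, Set.mem_ofPred_eq] at hC ⊢
  exact ⟨isMaxChain_map_perm σ hC.1, Finset.mem_map.2 ⟨A, hC.2, rfl⟩⟩

open Classical in
-- Permutations of the ground set make the number of chains through a set depend only on its size,
-- and each maximal chain meets each level once; double counting does the rest.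
lemma choose_mul_card_maxChains_through {n : ℕ} (A : BoolLattice n) :
    n.choose A.card * ((maxChains n).filter fun C => A ∈ C).card = (maxChains n).card := by
  have hA : A.card ≤ n := by simpa using A.card_le_univ
  have h1 : ∑ B ∈ Finset.powersetCard A.card (Finset.univ : Finset (Fin n)),
      ((maxChains n).filter fun C => B ∈ C).card =
      n.choose A.card * ((maxChains n).filter fun C => A ∈ C).card := by
    rw [Finset.sum_congr rfl (g := fun _ => ((maxChains n).filter fun C => A ∈ C).card)]
    · simp
    · intro B hB
      have := (Finset.mem_powersetCard.1 hB).2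
      exact le_antisymm (card_maxChains_through_le this) (card_maxChains_through_le this.symm)
  rw [← h1]
  simp_rw [Finset.card_filter]
  rw [Finset.sum_comm, Finset.card_eq_sum_ones (maxChains n)]
  refine Finset.sum_congr rfl fun C hC => ?_
  rw [← Finset.card_filter, ← card_filter_card_eq_of_isMaxChain hA (mem_maxChains.1 hC)]
  congr 1
  ext B
  simp [Finset.mem_powersetCard, and_comm]

lemma lubell_eq_sum {n : ℕ} (F : Finset (BoolLattice n)) :
    lubell F = ∑ A ∈ F, (n.choose A.card : ℝ)⁻¹ := by
  classical
  have hN : ((maxChains n).card : ℝ) ≠ 0 := by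
    simpa using (maxChains_nonempty n).ne_empty
  rw [lubell, div_eq_iff hN, Finset.sum_mul]
  have h1 : ∀ C ∈ maxChains n, ((F ∩ C).card : ℝ) = ∑ A ∈ F, if A ∈ C then (1 : ℝ) else 0 := by
    intro C _
    rw [← Finset.filter_mem_eq_inter, Finset.card_filter]
    push_cast
    rfl
  rw [Finset.sum_congr rfl h1, Finset.sum_comm]
  refine Finset.sum_congr rfl fun A _ => ?_
  rw [← choose_mul_card_maxChains_through A, Finset.card_filter]
  have hA : A.card ≤ n := by simpa using A.card_le_univ
  have : (n.choose A.card : ℝ) ≠ 0 := by exact_mod_cast (Nat.choose_pos hA).ne'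
  push_cast
  field_simp

/-! ### Induced diamonds above the empty set -/

lemma finset_fin_two_cases (X : BoolLattice 2) :
    X = ∅ ∨ X = {0} ∨ X = {1} ∨ X = {0, 1} := by
  revert X
  decide

/-- In a diamond-free family containing `∅`, the members below a given member form a chain. -/
lemma IsPosetFree.subset_total {n : ℕ} {F : Finset (BoolLattice n)}
    (hF : IsPosetFree (BoolLattice 2) F) (h0 : ∅ ∈ F) {A B D : BoolLattice n}
    (hA : A ∈ F) (hB : B ∈ F) (hD : D ∈ F) (hAD : A ⊆ D) (hBD : B ⊆ D) : A ⊆ B ∨ B ⊆ A := by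
  by_contra! h
  obtain ⟨hAB, hBA⟩ := h
  have hA0 : ¬ A ⊆ ∅ := fun h => hAB (h.trans (Finset.empty_subset _))
  have hB0 : ¬ B ⊆ ∅ := fun h => hBA (h.trans (Finset.empty_subset _))
  have hD0 : ¬ D ⊆ ∅ := fun h => hA0 (hAD.trans h)
  have hDA : ¬ D ⊆ A := fun h => hBA (hBD.trans h)
  have hDB : ¬ D ⊆ B := fun h => hAB (hAD.trans h)
  let f : BoolLattice 2 → {A : BoolLattice n // A ∈ F} := fun X =>
    if X = ∅ then ⟨∅, h0⟩ else if X = {0} then ⟨A, hA⟩ else if X = {1} then ⟨B, hB⟩ else ⟨D, hD⟩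
  have f0 : f ∅ = ⟨∅, h0⟩ := rfl
  have f1 : f {0} = ⟨A, hA⟩ := rfl
  have f2 : f {1} = ⟨B, hB⟩ := rfl
  have f3 : f {0, 1} = ⟨D, hD⟩ := rfl
  have key : ∀ X Y, f X ≤ f Y ↔ X ≤ Y := by
    intro X Y
    rcases finset_fin_two_cases X with rfl | rfl | rfl | rfl <;>
    rcases finset_fin_two_cases Y with rfl | rfl | rfl | rfl <;>
    simp only [f0, f1, f2, f3, Subtype.mk_le_mk, hAD, hBD, hAB, hBA, hA0, hB0,
      hD0, hDA, hDB, Finset.empty_subset, Finset.Subset.refl, true_iff, false_iff] <;>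
    decide
  exact hF.false (OrderEmbedding.ofMapLEIff f key)

/-- Nonemptiness may be assumed of `A` and `B` because the two middle elements of a diamond lie
strictly above its bottom. -/
lemma isPosetFree_of_subset_total {n : ℕ} {F : Finset (BoolLattice n)}
    (h : ∀ A ∈ F, ∀ B ∈ F, ∀ D ∈ F, A.Nonempty → B.Nonempty → A ⊂ D → B ⊂ D → A ⊆ B ∨ B ⊆ A) :
    IsPosetFree (BoolLattice 2) F := by
  refine ⟨fun f => ?_⟩
  have lt : ∀ X Y, X < Y → (f X).1 ⊂ (f Y).1 := fun X Y hXY => f.lt_iff_lt.2 hXY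
  have le : ∀ X Y, (f X).1 ⊆ (f Y).1 → X ≤ Y := fun X Y hXY => f.le_iff_le.1 hXY
  have ne : ∀ X, ∅ < X → (f X).1.Nonempty := fun X hX =>
    Finset.nonempty_iff_ne_empty.2 fun h' => by
      have := lt _ _ hX
      rw [h'] at this
      exact Finset.not_ssubset_empty _ this
  rcases h _ (f {0}).2 _ (f {1}).2 _ (f {0, 1}).2 (ne _ (by decide)) (ne _ (by decide))
    (lt _ _ (by decide)) (lt _ _ (by decide)) with h' | h'
  · exact absurd (le _ _ h') (by decide)
  · exact absurd (le _ _ h') (by decide)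

/-! ### Lubell mass below a set -/

/-- The expected number of members of `F` on a random maximal chain from `∅` to `B`. -/
noncomputable def downLubell {n : ℕ} (F : Finset (BoolLattice n)) (B : BoolLattice n) : ℝ :=
  ∑ A ∈ F, if A ⊆ B then (B.card.choose A.card : ℝ)⁻¹ else 0

lemma lubell_eq_downLubell_univ {n : ℕ} (F : Finset (BoolLattice n)) :
    lubell F = downLubell F Finset.univ := by
  simp [lubell_eq_sum, downLubell]

/-- The set just below `B` on a random chain is `B.erase x` with `x` uniform in `B`. For each `A ⊂
B` this is the identity `C(k,a)(k+1) = C(k+1,a)(k+1-a)`. -/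
lemma downLubell_eq_ite_add {n : ℕ} (F : Finset (BoolLattice n)) {B : BoolLattice n}
    (hB : B.Nonempty) :
    downLubell F B = (if B ∈ F then 1 else 0) +
      (∑ x ∈ B, downLubell F (B.erase x)) / (B.card : ℝ) := by
  classical
  have key : ∀ A ∈ F, (if A ⊆ B then (B.card.choose A.card : ℝ)⁻¹ else 0) =
      (if B = A then 1 else 0) + (∑ x ∈ B, if A ⊆ B.erase x then
        ((B.erase x).card.choose A.card : ℝ)⁻¹ else 0) / (B.card : ℝ) := by
    intro A _
    obtain ⟨k, hk⟩ : ∃ k, B.card = k + 1 := ⟨B.card - 1, by have := hB.card_pos; omega⟩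
    by_cases hAB : A ⊆ B
    · have hsum : (∑ x ∈ B, if A ⊆ B.erase x then ((B.erase x).card.choose A.card : ℝ)⁻¹ else 0)
          = ((k + 1 - A.card : ℕ) : ℝ) * (k.choose A.card : ℝ)⁻¹ := by
        rw [Finset.sum_congr rfl (g := fun x => if x ∉ A then (k.choose A.card : ℝ)⁻¹ else 0)]
        · rw [← Finset.sum_filter, Finset.filter_notMem_eq_sdiff, Finset.sum_const,
            Finset.card_sdiff_of_subset hAB, hk, nsmul_eq_mul]
        · intro x hx
          simp [Finset.subset_erase, hAB, Finset.card_erase_of_mem hx, hk]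
      rw [hsum, if_pos hAB, hk]
      by_cases hBA : B = A
      · subst hBA
        simp [hk]
      · have hlt : A.card < k + 1 := by
          rw [← hk]
          exact Finset.card_lt_card (hAB.ssubset_of_ne (Ne.symm hBA))
        have h1 : (k.choose A.card : ℝ) ≠ 0 := by
          exact_mod_cast (Nat.choose_pos (by omega)).ne'
        have h2 : ((k + 1).choose A.card : ℝ) ≠ 0 := by
          exact_mod_cast (Nat.choose_pos (by omega)).ne'
        have h3 : (k.choose A.card : ℝ) * ((k + 1 : ℕ) : ℝ) =
            ((k + 1).choose A.card : ℝ) * ((k + 1 - A.card : ℕ) : ℝ) := by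
          exact_mod_cast Nat.choose_mul_succ_eq k A.card
        have h4 : ((k + 1 : ℕ) : ℝ) ≠ 0 := by positivity
        rw [if_neg hBA, zero_add]
        field_simp
        linarith
    · have hBA : B ≠ A := fun h => hAB h.ge
      rw [if_neg hAB, if_neg hBA, Finset.sum_eq_zero]
      · simp
      · intro x _
        rw [if_neg]
        exact fun h => hAB (h.trans (Finset.erase_subset _ _))
  rw [downLubell, Finset.sum_congr rfl key, Finset.sum_add_distrib, Finset.sum_ite_eq,
    ← Finset.sum_div, Finset.sum_comm]
  rfl

/-- A bound for the Lubell mass below the members of `F` holds below every set. -/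
lemma downLubell_le_of_forall_mem {n : ℕ} {F : Finset (BoolLattice n)} {c : ℝ} (hc : 0 ≤ c)
    (h : ∀ B ∈ F, downLubell F B ≤ c) (B : BoolLattice n) : downLubell F B ≤ c := by
  induction B using Finset.strongInduction with
  | H B ih =>
    by_cases hB : B ∈ F
    · exact h B hB
    rcases B.eq_empty_or_nonempty with rfl | hne
    · refine le_of_eq_of_le (Finset.sum_eq_zero fun A hA => if_neg fun hA' => hB ?_) hc
      rwa [← Finset.subset_empty.1 hA']
    · rw [downLubell_eq_ite_add F hne, if_neg hB, zero_add,
        div_le_iff₀ (by exact_mod_cast hne.card_pos)]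
      calc _ ≤ ∑ _x ∈ B, c := Finset.sum_le_sum fun x hx => ih _ (Finset.erase_ssubset hx)
        _ = _ := by rw [Finset.sum_const, nsmul_eq_mul, mul_comm]

/-! ### The upper bound for families in which the members below a member form a chain -/

lemma choose_two_le_choose {k j : ℕ} (hj : 2 ≤ j) (hjk : j + 2 ≤ k) :
    k.choose 2 ≤ k.choose j := by
  induction k generalizing j with
  | zero => omega
  | succ k ih =>
    obtain ⟨i, rfl⟩ : ∃ i, j = i + 1 := ⟨j - 1, by omega⟩
    rw [Nat.choose_succ_succ' k 1, Nat.choose_succ_succ' k i, Nat.choose_one_right,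
      one_add_one_eq_two]
    have h1 : k ≤ k.choose i := by
      rcases Nat.lt_or_ge i 2 with h | h
      · obtain rfl : i = 1 := by omega
        simp
      · have h2 := ih h (by omega)
        have h3 : k ≤ k.choose 2 := by
          rw [Nat.choose_two_right, Nat.le_div_iff_mul_le (by norm_num)]
          exact Nat.mul_le_mul_left _ (by omega)
        exact h3.trans h2
    rcases Nat.lt_or_ge k (i + 3) with h | h
    · obtain rfl : k = i + 2 := by omega
      have h2 : (i + 2).choose (i + 1) = i + 2 := by
        rw [Nat.choose_succ_self_right]
      have h3 : (i + 2).choose i = (i + 2).choose 2 := by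
        rw [← Nat.choose_symm (by omega : i ≤ i + 2)]
        congr 1
        omega
      omega
    · have := ih hj (by omega)
      omega

/-- The extremal case is `k = 4`, where `1/6 + 1/4 + 1 = 17/12`. For larger `k`, all terms except
the last two are at most `1 / C(k,2)`. -/
lemma sum_inv_choose_le {k : ℕ} (hk : 2 ≤ k) :
    ∑ j ∈ Finset.Icc 2 k, (k.choose j : ℝ)⁻¹ ≤ 17 / 12 := by
  obtain ⟨i, rfl⟩ : ∃ i, k = i + 2 := ⟨k - 2, by omega⟩
  rcases i with _ | _ | i
  · norm_num
  · rw [Finset.sum_Icc_succ_top (by norm_num)]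
    norm_num
  have h1 : ∑ j ∈ Finset.Icc 2 (i + 2), ((i + 4).choose j : ℝ)⁻¹ ≤
      (i + 1 : ℝ) * ((i + 4).choose 2 : ℝ)⁻¹ := by
    calc _ ≤ ∑ j ∈ Finset.Icc 2 (i + 2), ((i + 4).choose 2 : ℝ)⁻¹ := by
          refine Finset.sum_le_sum fun j hj => ?_
          rw [Finset.mem_Icc] at hj
          have h := choose_two_le_choose hj.1 (show j + 2 ≤ i + 4 by omega)
          have h0 : 0 < (i + 4).choose 2 := Nat.choose_pos (by omega)
          gcongr
      _ = _ := by simp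
  rw [show i + 1 + 1 + 2 = i + 4 by ring, Finset.sum_Icc_succ_top (by omega),
    Finset.sum_Icc_succ_top (by omega)]
  have h2 : (i + 4).choose (i + 3) = i + 4 := by rw [Nat.choose_succ_self_right]
  have h3 : ((i + 4).choose 2 : ℝ) = (i + 4) * (i + 3) / 2 := by
    rw [Nat.cast_choose_two]; push_cast; ring
  rw [h3] at h1
  rw [h2, Nat.choose_self]
  refine le_trans (add_le_add_left (add_le_add_left h1 _) _) ?_
  push_cast
  rw [inv_div, ← sub_nonneg]
  have : (17 / 12 : ℝ) - ((i + 1) * (2 / ((i + 4) * (i + 3))) + (i + 4 : ℝ)⁻¹ + 1⁻¹) =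
      i * (5 * i - 1) / (12 * (i + 4) * (i + 3)) := by
    field_simp
    ring
  rw [this]
  refine div_nonneg ?_ (by positivity)
  rcases i with _ | i
  · simp
  · push_cast
    have : (0 : ℝ) ≤ i := by positivity
    nlinarith

/-- The points whose singletons belong to the family `G`. -/
def singletonPoints {n : ℕ} (G : Finset (BoolLattice n)) : Finset (Fin n) :=
  Finset.univ.filter fun x => {x} ∈ G

/-- The members of `G` below any given member form a chain. -/
def HasChainLowerSets {n : ℕ} (G : Finset (BoolLattice n)) : Prop :=
  ∀ A ∈ G, ∀ B ∈ G, ∀ D ∈ G, A ⊆ D → B ⊆ D → A ⊆ B ∨ B ⊆ A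

section ChainLowerSets

variable {n : ℕ} {G : Finset (BoolLattice n)}

lemma HasChainLowerSets.card_inter_singletonPoints_le_one (hG : HasChainLowerSets G)
    {B : BoolLattice n} (hB : B ∈ G) : (B ∩ singletonPoints G).card ≤ 1 := by
  rw [Finset.card_le_one]
  intro x hx y hy
  simp only [singletonPoints, Finset.mem_inter, Finset.mem_filter, Finset.mem_univ,
    true_and] at hx hy
  rcases hG _ hx.2 _ hy.2 _ hB (by simpa using hx.1) (by simpa using hy.1) with h | h
  · simpa using h
  · simpa [eq_comm] using h

/-- Below a member, a chain has at most one set of each size. The singletons are kept apart so that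
their contribution can be tracked through `S`. -/
lemma HasChainLowerSets.downLubell_mem_le (hG : HasChainLowerSets G) (h0 : ∅ ∉ G)
    {B : BoolLattice n} (hB : B ∈ G) :
    downLubell G B ≤ ((B ∩ singletonPoints G).card : ℝ) / B.card +
      ∑ j ∈ Finset.Icc 2 B.card, (B.card.choose j : ℝ)⁻¹ := by
  classical
  rw [downLubell, ← Finset.sum_filter,
    ← Finset.sum_filter_add_sum_filter_not _ (fun A => A.card = 1)]
  refine add_le_add ?_ ?_
  · have hsub : ((G.filter (· ⊆ B)).filter fun A => A.card = 1) ⊆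
        (B ∩ singletonPoints G).image fun x => {x} := by
      intro A hA
      simp only [Finset.mem_filter] at hA
      obtain ⟨x, rfl⟩ := Finset.card_eq_one.1 hA.2
      simpa [singletonPoints] using hA.1.symm
    have hcard := (Finset.card_le_card hsub).trans Finset.card_image_le
    rw [Finset.sum_congr rfl (g := fun _ => (B.card : ℝ)⁻¹), Finset.sum_const, nsmul_eq_mul,
      div_eq_mul_inv]
    · gcongr
    · intro A hA
      rw [(Finset.mem_filter.1 hA).2, Nat.choose_one_right]
  · have hinj : Set.InjOn Finset.card
        (((G.filter (· ⊆ B)).filter fun A => ¬ A.card = 1 : Finset (BoolLattice n)) :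
          Set (BoolLattice n)) := by
      intro A hA A' hA' hcard
      simp only [Finset.coe_filter, Set.mem_ofPred_eq, Finset.mem_filter] at hA hA'
      rcases hG A hA.1.1 A' hA'.1.1 B hB hA.1.2 hA'.1.2 with h | h
      · exact Finset.eq_of_subset_of_card_le h hcard.ge
      · exact (Finset.eq_of_subset_of_card_le h hcard.le).symm
    rw [← Finset.sum_image (f := fun j => (B.card.choose j : ℝ)⁻¹) hinj]
    refine Finset.sum_le_sum_of_subset_of_nonneg ?_ fun _ _ _ => by positivity
    intro j hj
    obtain ⟨A, hA, rfl⟩ := Finset.mem_image.1 hj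
    simp only [Finset.mem_filter] at hA
    have h1 := Finset.card_le_card hA.1.2
    have h2 : A.card ≠ 0 := fun h => h0 (Finset.card_eq_zero.1 h ▸ hA.1.1)
    have h3 := hA.2
    rw [Finset.mem_Icc]
    omega

/-- Deleting a point of `B` lowers the intersection with `S` by one exactly when the point lies in
`S`. -/
lemma sum_card_erase_inter (S B : Finset (Fin n)) (g : ℝ → ℝ) :
    ∑ x ∈ B, g ((B.erase x ∩ S).card : ℝ) = (B ∩ S).card * g ((B ∩ S).card - 1) +
      (B.card - (B ∩ S).card) * g (B ∩ S).card := by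
  classical
  rw [← Finset.sum_filter_add_sum_filter_not B (· ∈ S)]
  congr 1
  · rw [Finset.sum_congr rfl (g := fun _ => g ((B ∩ S).card - 1)), Finset.sum_const,
      Finset.filter_mem_eq_inter, nsmul_eq_mul]
    intro x hx
    rw [Finset.filter_mem_eq_inter] at hx
    rw [Finset.erase_inter, Finset.card_erase_of_mem hx, Nat.cast_pred (Finset.card_pos.2 ⟨x, hx⟩)]
  · rw [Finset.sum_congr rfl (g := fun _ => g (B ∩ S).card), Finset.sum_const,
      nsmul_eq_mul]
    · congr 1
      rw [Finset.filter_notMem_eq_sdiff, eq_sub_iff_add_eq]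
      exact_mod_cast Finset.card_sdiff_add_card_inter B S
    · intro x hx
      rw [Finset.erase_inter, Finset.erase_eq_of_notMem]
      simp only [Finset.mem_filter] at hx
      simp [hx.2]

lemma downLubell_le_ite_add {k : ℕ} {g : ℝ → ℝ} (S : Finset (Fin n))
    (hg : ∀ B : BoolLattice n, B.card = k → downLubell G B ≤ g ((B ∩ S).card : ℝ))
    {B : BoolLattice n} (hB : B.card = k + 1) :
    downLubell G B ≤ (if B ∈ G then 1 else 0) + ((B ∩ S).card * g ((B ∩ S).card - 1) +
      ((k + 1 : ℕ) - (B ∩ S).card) * g (B ∩ S).card) / (k + 1 : ℕ) := by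
  rw [downLubell_eq_ite_add G (Finset.card_pos.1 (by omega)), ← hB, ← sum_card_erase_inter]
  gcongr with x hx
  exact hg _ (by rw [Finset.card_erase_of_mem hx, hB]; rfl)

lemma downLubell_le_of_card_eq_one (h0 : ∅ ∉ G) {B : BoolLattice n} (hB : B.card = 1) :
    downLubell G B ≤ (B ∩ singletonPoints G).card := by
  have h := downLubell_le_ite_add (G := G) (k := 0) (g := fun _ => 0) (singletonPoints G) (by
    intro A hA
    rw [Finset.card_eq_zero.1 hA, downLubell, Finset.sum_eq_zero]
    intro A' hA'
    rw [if_neg]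
    intro h
    exact h0 (Finset.subset_empty.1 h ▸ hA')) hB
  obtain ⟨x, rfl⟩ := Finset.card_eq_one.1 hB
  refine h.trans ?_
  by_cases hx : {x} ∈ G
  · have : ({x} : Finset (Fin n)) ∩ singletonPoints G = {x} := by
      simp [singletonPoints, hx]
    simp [hx, this]
  · simp [hx]

/-- The bound takes the values 1, 3/2, 1 at `s = 0, 1, 2`: a pair with both singletons in `G` cannot
itself be in `G`. This loss is what makes the final bound smaller for large `s`. -/
lemma HasChainLowerSets.downLubell_le_of_card_eq_two (hG : HasChainLowerSets G) (h0 : ∅ ∉ G)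
    {B : BoolLattice n} (hB : B.card = 2) :
    downLubell G B ≤ 1 + ((B ∩ singletonPoints G).card : ℝ) / 2 -
      ((B ∩ singletonPoints G).card : ℝ) * ((B ∩ singletonPoints G).card - 1) / 2 := by
  have h := downLubell_le_ite_add (G := G) (k := 1) (g := fun s => s) (singletonPoints G)
    (fun _ => downLubell_le_of_card_eq_one h0) hB
  have hs : (B ∩ singletonPoints G).card ≤ 2 := hB ▸ Finset.card_le_card Finset.inter_subset_left
  have h1 := fun hBG : B ∈ G => hG.card_inter_singletonPoints_le_one hBG
  refine h.trans ?_
  generalize (B ∩ singletonPoints G).card = s at *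
  split_ifs with hBG
  · have := h1 hBG
    interval_cases s <;> norm_num
  · interval_cases s <;> norm_num

/-- A bound for the Lubell mass below a `k`-set, `k ≥ 3`, that contains `s` of the points whose
singletons belong to the family. -/
noncomputable def chainLowerBound (k s : ℝ) : ℝ :=
  17 / 12 + s / k - 9 / 4 * (s * (s - 1) / (k * (k - 1))) +
    s * (s - 1) * (s - 2) / (k * (k - 1) * (k - 2))

/-- Each of `s/k`, `s(s-1)/(k(k-1))`, `s(s-1)(s-2)/(k(k-1)(k-2))` is the probability that a random
1-, 2- or 3-subset of the `k`-set lies in `S`. Such probabilities are preserved when one averages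
over deletion of a point. -/
lemma chainLowerBound_average {k : ℝ} (hk : 3 ≤ k) (s : ℝ) :
    (s * chainLowerBound k (s - 1) + (k + 1 - s) * chainLowerBound k s) / (k + 1) =
      chainLowerBound (k + 1) s := by
  have h0 : k ≠ 0 := by linarith
  have h1 : k - 1 ≠ 0 := by linarith
  have h2 : k - 2 ≠ 0 := by linarith
  have h3 : k + 1 ≠ 0 := by linarith
  have e1 : k + 1 - 1 = k := by ring
  have e2 : k + 1 - 2 = k - 1 := by ring
  unfold chainLowerBound
  rw [e1, e2]
  field_simp
  ring

/-- For `B ∈ G` we have `s ≤ 1`, so the quadratic and cubic terms vanish and what remains is the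
chain bound. Otherwise averaging applies. The coefficient 9/4 makes the base case tight at `s = 2`;
the cubic term restores enough at `s = 3`. -/
lemma HasChainLowerSets.downLubell_le (hG : HasChainLowerSets G) (h0 : ∅ ∉ G)
    {k : ℕ} (hk : 3 ≤ k) {B : BoolLattice n} (hB : B.card = k) :
    downLubell G B ≤ chainLowerBound k (B ∩ singletonPoints G).card := by
  induction k, hk using Nat.le_induction generalizing B with
  | base =>
    by_cases hBG : B ∈ G
    · refine (hG.downLubell_mem_le h0 hBG).trans ?_
      have h1 := hG.card_inter_singletonPoints_le_one hBG
      rw [hB]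
      have h2 := sum_inv_choose_le (k := 3) (by norm_num)
      unfold chainLowerBound
      generalize (B ∩ singletonPoints G).card = s at *
      interval_cases s <;> norm_num at h2 ⊢ <;> linarith
    · refine (downLubell_le_ite_add (G := G)
        (g := fun s => 1 + s / 2 - s * (s - 1) / 2) (singletonPoints G)
        (fun _ => hG.downLubell_le_of_card_eq_two h0) hB).trans ?_
      have hs : (B ∩ singletonPoints G).card ≤ 3 :=
        hB ▸ Finset.card_le_card Finset.inter_subset_left
      rw [if_neg hBG]
      unfold chainLowerBound
      generalize (B ∩ singletonPoints G).card = s at *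
      interval_cases s <;> norm_num
  | succ k hk ih =>
    by_cases hBG : B ∈ G
    · refine (hG.downLubell_mem_le h0 hBG).trans ?_
      have h1 := hG.card_inter_singletonPoints_le_one hBG
      rw [hB]
      have h2 := sum_inv_choose_le (k := k + 1) (by omega)
      unfold chainLowerBound
      generalize (B ∩ singletonPoints G).card = s at *
      interval_cases s <;> norm_num at h2 ⊢ <;> linarith
    · refine (downLubell_le_ite_add (G := G) (g := chainLowerBound k) (singletonPoints G)
        (fun _ h => ih h) hB).trans ?_
      rw [if_neg hBG, zero_add]
      push_cast
      rw [chainLowerBound_average (by exact_mod_cast hk)]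

end ChainLowerSets

lemma chainLowerBound_le {k s : ℕ} (hk : 100 ≤ k) (hs : s ≤ k) :
    chainLowerBound k s ≤ 1.57 := by
  have hk' : (100 : ℝ) ≤ k := by exact_mod_cast hk
  have hs' : (s : ℝ) ≤ k := by exact_mod_cast hs
  have hs0 : (0 : ℝ) ≤ s := by positivity
  have h1 : (0 : ℝ) < k - 1 := by linarith
  have h2 : (0 : ℝ) < k - 2 := by linarith
  set α : ℝ := s / k with hα
  have hα0 : 0 ≤ α := by positivity
  have hα1 : α ≤ 1 := by rw [hα, div_le_one (by linarith)]; exact hs'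
  have hsα : (s : ℝ) = α * k := by rw [hα]; field_simp
  -- The error in replacing the quotient by `α ^ 2` is `α(1 - α)/(k - 1)`, and 0.0101011 slightly
  -- exceeds 1/99.
  have hb : α ^ 2 - 0.0101011 ≤ (s : ℝ) * (s - 1) / (k * (k - 1)) := by
    rw [le_div_iff₀ (by positivity), hsα]
    have : 0 ≤ (k : ℝ) * (α * (α - 1) + 0.0101011 * (k - 1)) :=
      mul_nonneg (by linarith) (by nlinarith)
    nlinarith
  have hc : (s : ℝ) * (s - 1) * (s - 2) / (k * (k - 1) * (k - 2)) ≤ α ^ 3 := by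
    rcases Nat.lt_or_ge s 2 with h | h
    · interval_cases s
      · norm_num at hα ⊢
        positivity
      · norm_num
        positivity
    have h' : (2 : ℝ) ≤ s := by exact_mod_cast h
    have a1 : ((s : ℝ) - 1) / (k - 1) ≤ α := by
      rw [div_le_iff₀ h1, hsα]; nlinarith
    have a2 : ((s : ℝ) - 2) / (k - 2) ≤ α := by
      rw [div_le_iff₀ h2, hsα]; nlinarith
    calc (s : ℝ) * (s - 1) * (s - 2) / (k * (k - 1) * (k - 2))
        = α * (((s : ℝ) - 1) / (k - 1)) * (((s : ℝ) - 2) / (k - 2)) := by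
          rw [hα]; field_simp
      _ ≤ α * α * α := by
          have b1 : 0 ≤ ((s : ℝ) - 1) / (k - 1) := div_nonneg (by linarith) h1.le
          have b2 : 0 ≤ ((s : ℝ) - 2) / (k - 2) := div_nonneg (by linarith) h2.le
          gcongr
      _ = α ^ 3 := by ring
  unfold chainLowerBound
  -- The cubic has its maximum on `[0, 1]` at `α ≈ 0.2713`, a root of `1 - 9/2 α + 3 α²`.
  have : 17 / 12 + α - 9 / 4 * α ^ 2 + α ^ 3 ≤ 1.5424 := by
    nlinarith [mul_nonneg (sub_nonneg.2 hα1) (sq_nonneg (α - 0.2713)),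
      mul_nonneg hα0 (sq_nonneg (α - 0.2713)), sq_nonneg (α - 0.2713)]
  linarith

lemma lubell_le_of_isPosetFree {n : ℕ} (hn : 100 ≤ n) {F : Finset (BoolLattice n)}
    (h0 : ∅ ∈ F) (hF : IsPosetFree (BoolLattice 2) F) : lubell F ≤ 2.57 := by
  classical
  have hG : HasChainLowerSets (F.erase ∅) := fun A hA B hB D hD hAD hBD =>
    hF.subset_total h0 (Finset.mem_of_mem_erase hA) (Finset.mem_of_mem_erase hB)
      (Finset.mem_of_mem_erase hD) hAD hBD
  have h1 := hG.downLubell_le (Finset.notMem_erase _ _) (k := n) (by omega)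
    (B := Finset.univ) (by simp)
  have h2 := h1.trans (chainLowerBound_le hn (by simpa using Finset.card_le_univ (Finset.univ ∩ singletonPoints (F.erase ∅))))
  rw [← lubell_eq_downLubell_univ, lubell_eq_sum] at h2
  rw [lubell_eq_sum, ← Finset.add_sum_erase _ _ h0]
  norm_num at h2 ⊢
  linarith

lemma rhoStar_boolLattice_two_lt : rhoStar (BoolLattice 2) < ((2.5823284 : ℝ) : EReal) := by
  refine lt_of_le_of_lt (b := ((2.57 : ℝ) : EReal)) ?_ (by norm_cast; norm_num)
  refine limsup_le_of_le (by isBoundedDefault) ?_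
  filter_upwards [eventually_ge_atTop 100] with n hn
  refine iSup₂_le fun F hF => ?_
  exact_mod_cast lubell_le_of_isPosetFree hn hF.1 hF.2

/-! ### The lower bound -/

/-- The sizes of the intersections of `A` with three given sets. -/
def interCards {n : ℕ} (P Q R A : Finset (Fin n)) : ℕ × ℕ × ℕ :=
  ((A ∩ P).card, (A ∩ Q).card, (A ∩ R).card)

/-- The sets whose intersection sizes with `P`, `Q`, `R` belong to `T`. -/
def familyOfTypes {n : ℕ} (P Q R : Finset (Fin n)) (T : Finset (ℕ × ℕ × ℕ)) :
    Finset (BoolLattice n) :=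
  Finset.univ.filter fun A => interCards P Q R A ∈ T

/-- A set of types that spans families without an induced diamond. -/
def diamondFreeTypes : Finset (ℕ × ℕ × ℕ) :=
  {(0, 0, 0), (1, 0, 0), (1, 1, 0), (0, 2, 0), (1, 1, 1), (1, 0, 2), (0, 1, 2), (0, 0, 3),
    (0, 2, 1)}

/-- In each part, either `A` is absent or `B` already has as many points as `D`, hence all of them.
So `A ⊆ B` holds part by part, and comparability below `D` reduces to a finite check on triples. -/
lemma diamondFreeTypes_eq_zero_or_eq : ∀ d ∈ diamondFreeTypes, ∀ a ∈ diamondFreeTypes,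
    ∀ b ∈ diamondFreeTypes, a ≤ d → b ≤ d → a ≠ 0 → a.1 + a.2.1 + a.2.2 ≤ b.1 + b.2.1 + b.2.2 →
    b.1 + b.2.1 + b.2.2 < d.1 + d.2.1 + d.2.2 →
    (a.1 = 0 ∨ b.1 = d.1) ∧ (a.2.1 = 0 ∨ b.2.1 = d.2.1) ∧ (a.2.2 = 0 ∨ b.2.2 = d.2.2) := by
  decide

section ThreeParts

variable {n : ℕ} {P Q R : Finset (Fin n)}

lemma card_eq_sum_card_inter (hPQ : Disjoint P Q) (hPR : Disjoint P R) (hQR : Disjoint Q R)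
    (hU : P ∪ Q ∪ R = Finset.univ) (A : Finset (Fin n)) :
    A.card = (A ∩ P).card + (A ∩ Q).card + (A ∩ R).card := by
  rw [← Finset.card_union_of_disjoint, ← Finset.card_union_of_disjoint,
    ← Finset.inter_union_distrib_left, ← Finset.inter_union_distrib_left, hU, Finset.inter_univ]
  · rw [← Finset.inter_union_distrib_left]
    exact (Finset.disjoint_union_left.2 ⟨hPR, hQR⟩).mono Finset.inter_subset_right
      Finset.inter_subset_right
  · exact hPQ.mono Finset.inter_subset_right Finset.inter_subset_right

lemma inter_subset_inter_of_card {A B D X : Finset (Fin n)} (hA : A ⊆ D) (hB : B ⊆ D)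
    (h : (A ∩ X).card = 0 ∨ (B ∩ X).card = (D ∩ X).card) : A ∩ X ⊆ B ∩ X := by
  rcases h with h | h
  · rw [Finset.card_eq_zero.1 h]
    exact Finset.empty_subset _
  · rw [Finset.eq_of_subset_of_card_le (Finset.inter_subset_inter_right hB) h.ge]
    exact Finset.inter_subset_inter_right hA

lemma isPosetFree_familyOfTypes (hPQ : Disjoint P Q) (hPR : Disjoint P R) (hQR : Disjoint Q R)
    (hU : P ∪ Q ∪ R = Finset.univ) :
    IsPosetFree (BoolLattice 2) (familyOfTypes P Q R diamondFreeTypes) := by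
  have hcard := card_eq_sum_card_inter hPQ hPR hQR hU
  have key : ∀ A B D : BoolLattice n, interCards P Q R A ∈ diamondFreeTypes →
      interCards P Q R B ∈ diamondFreeTypes → interCards P Q R D ∈ diamondFreeTypes →
      A.Nonempty → A ⊂ D → B ⊂ D → A.card ≤ B.card → A ⊆ B := by
    intro A B D hA hB hD hA0 hAD hBD hAB
    have mono : ∀ X : BoolLattice n, X ⊆ D → interCards P Q R X ≤ interCards P Q R D :=
      fun X hX => ⟨Finset.card_le_card (Finset.inter_subset_inter_right hX),
        Finset.card_le_card (Finset.inter_subset_inter_right hX),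
        Finset.card_le_card (Finset.inter_subset_inter_right hX)⟩
    have hlt := Finset.card_lt_card hBD
    have hpos := hA0.card_pos
    rw [hcard A] at hpos
    rw [hcard A, hcard B] at hAB
    rw [hcard B, hcard D] at hlt
    obtain ⟨h1, h2, h3⟩ := diamondFreeTypes_eq_zero_or_eq _ hD _ hA _ hB (mono A hAD.1)
      (mono B hBD.1) (by
        intro h
        simp only [interCards, Prod.mk_eq_zero] at h
        omega) hAB hlt
    have hsub : ∀ X : BoolLattice n, X = X ∩ P ∪ X ∩ Q ∪ X ∩ R := fun X => by
      rw [← Finset.inter_union_distrib_left, ← Finset.inter_union_distrib_left, hU,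
        Finset.inter_univ]
    rw [hsub A, hsub B]
    exact Finset.union_subset_union (Finset.union_subset_union
      (inter_subset_inter_of_card hAD.1 hBD.1 h1) (inter_subset_inter_of_card hAD.1 hBD.1 h2))
      (inter_subset_inter_of_card hAD.1 hBD.1 h3)
  refine isPosetFree_of_subset_total fun A hA B hB D hD hA0 hB0 hAD hBD => ?_
  simp only [familyOfTypes, Finset.mem_filter, Finset.mem_univ, true_and] at hA hB hD
  rcases le_total A.card B.card with h | h
  · exact Or.inl (key A B D hA hB hD hA0 hAD hBD h)
  · exact Or.inr (key B A D hB hA hD hB0 hBD hAD h)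

lemma le_card_filter_interCards (hPQ : Disjoint P Q) (hPR : Disjoint P R) (hQR : Disjoint Q R)
    (i j k : ℕ) :
    P.card.choose i * Q.card.choose j * R.card.choose k ≤
      (Finset.univ.filter fun A : BoolLattice n => interCards P Q R A = (i, j, k)).card := by
  have hP : ∀ {X Y Z : Finset (Fin n)}, X ⊆ P → Y ⊆ Q → Z ⊆ R → (X ∪ Y ∪ Z) ∩ P = X := by
    intro X Y Z hX hY hZ
    rw [Finset.union_inter_distrib_right, Finset.union_inter_distrib_right,
      Finset.inter_eq_left.2 hX, Finset.disjoint_iff_inter_eq_empty.1 (hPQ.symm.mono_left hY),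
      Finset.disjoint_iff_inter_eq_empty.1 (hPR.symm.mono_left hZ)]
    simp
  have hQ : ∀ {X Y Z : Finset (Fin n)}, X ⊆ P → Y ⊆ Q → Z ⊆ R → (X ∪ Y ∪ Z) ∩ Q = Y := by
    intro X Y Z hX hY hZ
    rw [Finset.union_inter_distrib_right, Finset.union_inter_distrib_right,
      Finset.inter_eq_left.2 hY, Finset.disjoint_iff_inter_eq_empty.1 (hPQ.mono_left hX),
      Finset.disjoint_iff_inter_eq_empty.1 (hQR.symm.mono_left hZ)]
    simp
  have hR : ∀ {X Y Z : Finset (Fin n)}, X ⊆ P → Y ⊆ Q → Z ⊆ R → (X ∪ Y ∪ Z) ∩ R = Z := by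
    intro X Y Z hX hY hZ
    rw [Finset.union_inter_distrib_right, Finset.union_inter_distrib_right,
      Finset.inter_eq_left.2 hZ, Finset.disjoint_iff_inter_eq_empty.1 (hPR.mono_left hX),
      Finset.disjoint_iff_inter_eq_empty.1 (hQR.mono_left hY)]
    simp
  rw [← Finset.card_powersetCard, ← Finset.card_powersetCard, ← Finset.card_powersetCard,
    ← Finset.card_product, ← Finset.card_product]
  refine Finset.card_le_card_of_injOn (fun t => t.1.1 ∪ t.1.2 ∪ t.2) ?_ ?_
  · rintro ⟨⟨X, Y⟩, Z⟩ h
    simp only [Finset.coe_product, Set.mem_prod, Finset.mem_coe, Finset.mem_powersetCard] at h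
    obtain ⟨⟨⟨hX, hXi⟩, hY, hYj⟩, hZ, hZk⟩ := h
    refine Finset.mem_coe.2 (Finset.mem_filter.2 ⟨Finset.mem_univ _, ?_⟩)
    simp only [interCards, hP hX hY hZ, hQ hX hY hZ, hR hX hY hZ, hXi, hYj, hZk]
  · rintro ⟨⟨X, Y⟩, Z⟩ h ⟨⟨X', Y'⟩, Z'⟩ h' heq
    simp only [Finset.coe_product, Set.mem_prod, Finset.mem_coe, Finset.mem_powersetCard] at h h'
    obtain ⟨⟨⟨hX, -⟩, hY, -⟩, hZ, -⟩ := h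
    obtain ⟨⟨⟨hX', -⟩, hY', -⟩, hZ', -⟩ := h'
    simp only at heq
    have e1 := hP hX hY hZ
    have e2 := hQ hX hY hZ
    have e3 := hR hX hY hZ
    rw [heq] at e1 e2 e3
    rw [← e1, ← e2, ← e3, hP hX' hY' hZ', hQ hX' hY' hZ', hR hX' hY' hZ']

lemma le_lubell_familyOfTypes (hPQ : Disjoint P Q) (hPR : Disjoint P R) (hQR : Disjoint Q R)
    (hU : P ∪ Q ∪ R = Finset.univ) (T : Finset (ℕ × ℕ × ℕ)) :
    ∑ t ∈ T, ((P.card.choose t.1 * Q.card.choose t.2.1 * R.card.choose t.2.2 : ℕ) : ℝ) *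
      (n.choose (t.1 + t.2.1 + t.2.2) : ℝ)⁻¹ ≤ lubell (familyOfTypes P Q R T) := by
  rw [lubell_eq_sum, ← Finset.sum_fiberwise_of_maps_to (t := T) (g := interCards P Q R)
    (s := familyOfTypes P Q R T) (fun A hA => (Finset.mem_filter.1 hA).2)]
  refine Finset.sum_le_sum fun t ht => ?_
  have hfil : (familyOfTypes P Q R T).filter (fun A => interCards P Q R A = t) =
      Finset.univ.filter fun A => interCards P Q R A = t := by
    ext A
    simp only [familyOfTypes, Finset.mem_filter, Finset.mem_univ, true_and]
    exact ⟨fun h => h.2, fun h => ⟨h ▸ ht, h⟩⟩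
  rw [hfil, Finset.sum_congr rfl (g := fun _ => (n.choose (t.1 + t.2.1 + t.2.2) : ℝ)⁻¹),
    Finset.sum_const, nsmul_eq_mul]
  · gcongr
    exact le_card_filter_interCards hPQ hPR hQR _ _ _
  · intro A hA
    rw [card_eq_sum_card_inter hPQ hPR hQR hU A, ← (Finset.mem_filter.1 hA).2]
    rfl

end ThreeParts

lemma cast_choose_three (a : ℕ) : (a.choose 3 : ℝ) = a * (a - 1) * (a - 2) / 6 := by
  induction a with
  | zero => simp
  | succ a ih =>
    rw [Nat.choose_succ_succ' a 2]
    push_cast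
    rw [ih, Nat.cast_choose_two]
    ring

lemma exists_isPosetFree_lubell_ge {m : ℕ} (hm : 1 ≤ m) :
    ∃ F : Finset (BoolLattice (10 * m)), (∅ ∈ F ∧ IsPosetFree (BoolLattice 2) F) ∧
      2.284 ≤ lubell F := by
  -- With proportions 0.3, 0.5, 0.2 the nonempty types contribute 0.3, 0.3, 0.25, 0.18, 0.036, 0.06,
  -- 0.008, 0.15 in the limit, in the listed order.
  let P : Finset (Fin (10 * m)) := Finset.univ.filter fun x => x.1 < 3 * m
  let Q : Finset (Fin (10 * m)) := Finset.univ.filter fun x => 3 * m ≤ x.1 ∧ x.1 < 8 * m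
  let R : Finset (Fin (10 * m)) := Finset.univ.filter fun x => 8 * m ≤ x.1
  have hPQ : Disjoint P Q := Finset.disjoint_filter.2 fun x _ h => by omega
  have hPR : Disjoint P R := Finset.disjoint_filter.2 fun x _ h => by omega
  have hQR : Disjoint Q R := Finset.disjoint_filter.2 fun x _ h => by omega
  have hU : P ∪ Q ∪ R = Finset.univ := by
    ext x
    simp only [P, Q, R, Finset.mem_union, Finset.mem_filter, Finset.mem_univ, true_and, iff_true]
    omega
  have hP : P.card = 3 * m := by
    rw [Fin.card_filter_val_lt]
    omega
  have hPQc : (P ∪ Q).card = 8 * m := by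
    have h : P ∪ Q = Finset.univ.filter fun x : Fin (10 * m) => x.1 < 8 * m := by
      ext x
      simp only [P, Q, Finset.mem_union, Finset.mem_filter, Finset.mem_univ, true_and]
      omega
    rw [h, Fin.card_filter_val_lt]
    omega
  have hQ : Q.card = 5 * m := by
    have := Finset.card_union_of_disjoint hPQ
    omega
  have hR : R.card = 2 * m := by
    have := Finset.card_union_of_disjoint (Finset.disjoint_union_left.2 ⟨hPR, hQR⟩)
    rw [hU, Finset.card_univ, Fintype.card_fin] at this
    omega
  refine ⟨familyOfTypes P Q R diamondFreeTypes, ⟨?_, isPosetFree_familyOfTypes hPQ hPR hQR hU⟩, ?_⟩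
  · simp [familyOfTypes, interCards, diamondFreeTypes]
  refine le_trans ?_ (le_lubell_familyOfTypes hPQ hPR hQR hU _)
  rw [hP, hQ, hR]
  have hm' : (1 : ℝ) ≤ m := by exact_mod_cast hm
  simp only [diamondFreeTypes]
  repeat rw [Finset.sum_insert (by decide)]
  rw [Finset.sum_singleton]
  simp only [Nat.choose_zero_right, Nat.choose_one_right, mul_one, one_mul, add_zero, zero_add,
    Nat.reduceAdd, Nat.cast_mul, Nat.cast_one, Nat.cast_choose_two, cast_choose_three,
    Nat.cast_ofNat, inv_one]
  have h1 : (0 : ℝ) < 10 * m - 1 := by linarith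
  have h2 : (0 : ℝ) < 10 * m - 2 := by linarith
  have h3 : (0 : ℝ) < m := by linarith
  rw [← sub_nonneg]
  -- This fraction is the exact excess of the sum over 2.284, so the bound holds for every `m ≥ 1`
  -- and not only in the limit.
  have h4 : (0 : ℝ) ≤ (113 / 25 * m - 71 / 125) / ((10 * m - 1) * (10 * m - 2)) :=
    div_nonneg (by linarith) (by positivity)
  have h1' : (m * 10 - 1 : ℝ) ≠ 0 := by linarith
  have h2' : (m * 10 - 2 : ℝ) ≠ 0 := by linarith
  refine h4.trans_eq ?_
  field_simp
  ring

lemma lt_rhoStar_boolLattice_two : ((2.2818564 : ℝ) : EReal) < rhoStar (BoolLattice 2) := by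
  refine lt_of_lt_of_le (b := ((2.284 : ℝ) : EReal)) (by norm_cast; norm_num) ?_
  -- A limsup only needs infinitely many dimensions, so multiples of 10 suffice.
  refine le_limsup_of_frequently_le' (frequently_atTop.2 fun N => ?_)
  obtain ⟨F, hF, hle⟩ := exists_isPosetFree_lubell_ge (m := N + 1) (by omega)
  exact ⟨10 * (N + 1), by omega, le_iSup₂_of_le F hF (by exact_mod_cast hle)⟩

/-! ### From Lubell masses to sizes of families -/

/-- The embedding of `Fin (n - |A|)` onto the complement of `A`. -/
def complEmb {n : ℕ} (A : BoolLattice n) : Fin (n - A.card) ↪ Fin n :=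
  (Aᶜ.orderEmbOfFin (by rw [Finset.card_compl, Fintype.card_fin])).toEmbedding

lemma map_complEmb_univ {n : ℕ} (A : BoolLattice n) :
    Finset.univ.map (complEmb A) = Aᶜ := by
  refine Finset.eq_of_subset_of_card_le (fun x hx => ?_) ?_
  · obtain ⟨i, -, rfl⟩ := Finset.mem_map.1 hx
    exact Finset.orderEmbOfFin_mem _ _ i
  · rw [Finset.card_map, Finset.card_compl, Finset.card_univ, Fintype.card_fin, Fintype.card_fin]

lemma disjoint_map_complEmb {n : ℕ} (A : BoolLattice n) (E : Finset (Fin (n - A.card))) :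
    Disjoint A (E.map (complEmb A)) := by
  refine disjoint_compl_right.mono_right ?_
  rw [← map_complEmb_univ]
  exact Finset.map_subset_map.2 (Finset.subset_univ _)

/-- The subsets of an `(n - |A|)`-set, embedded as the sets that contain `A`. -/
def upperEmb {n : ℕ} (A : BoolLattice n) : BoolLattice (n - A.card) ↪o BoolLattice n :=
  OrderEmbedding.ofMapLEIff (fun E => A ∪ E.map (complEmb A)) (by
    intro E E'
    constructor
    · intro h
      have h1 : E.map (complEmb A) ⊆ E'.map (complEmb A) :=
        (disjoint_map_complEmb A E).symm.left_le_of_le_sup_left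
          (le_trans le_sup_right h)
      exact Finset.map_subset_map.1 h1
    · intro h
      exact Finset.union_subset_union_right (Finset.map_subset_map.2 h))

lemma upperEmb_apply {n : ℕ} (A : BoolLattice n) (E : BoolLattice (n - A.card)) :
    upperEmb A E = A ∪ E.map (complEmb A) := rfl

lemma card_upperEmb {n : ℕ} (A : BoolLattice n) (E : BoolLattice (n - A.card)) :
    (upperEmb A E).card = A.card + E.card := by
  rw [upperEmb_apply, Finset.card_union_of_disjoint (disjoint_map_complEmb A E), Finset.card_map]

lemma exists_upperEmb_eq {n : ℕ} {A D : BoolLattice n} (h : A ⊆ D) : ∃ E, upperEmb A E = D := by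
  have h1 : D \ A ⊆ Finset.univ.map (complEmb A) := by
    rw [map_complEmb_univ]
    intro x hx
    simpa using (Finset.mem_sdiff.1 hx).2
  obtain ⟨E, -, hE⟩ := Finset.subset_map_iff.1 h1
  exact ⟨E, by rw [upperEmb_apply, ← hE, Finset.union_sdiff_of_subset h]⟩

/-- The members of `F` that contain `A`, as a family on the complement of `A`. -/
def upperFamily {n : ℕ} (F : Finset (BoolLattice n)) (A : BoolLattice n) :
    Finset (BoolLattice (n - A.card)) :=
  Finset.univ.filter fun E => upperEmb A E ∈ F

lemma mem_upperFamily {n : ℕ} {F : Finset (BoolLattice n)} {A : BoolLattice n}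
    {E : BoolLattice (n - A.card)} : E ∈ upperFamily F A ↔ upperEmb A E ∈ F := by
  simp [upperFamily]

lemma empty_mem_upperFamily {n : ℕ} {F : Finset (BoolLattice n)} {A : BoolLattice n}
    (hA : A ∈ F) : ∅ ∈ upperFamily F A := by
  simpa [mem_upperFamily, upperEmb_apply] using hA

lemma IsPosetFree.upperFamily {P : Type*} [PartialOrder P] {n : ℕ} {F : Finset (BoolLattice n)}
    (hF : IsPosetFree P F) (A : BoolLattice n) : IsPosetFree P (upperFamily F A) := by
  refine ⟨fun f => hF.false (OrderEmbedding.ofMapLEIff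
    (fun p => ⟨upperEmb A (f p).1, mem_upperFamily.1 (f p).2⟩) fun p q => ?_)⟩
  rw [Subtype.mk_le_mk, (upperEmb A).le_iff_le]
  exact f.le_iff_le

lemma IsPosetFree.mono {P : Type*} [PartialOrder P] {n : ℕ} {F F' : Finset (BoolLattice n)}
    (hF : IsPosetFree P F) (h : F' ⊆ F) : IsPosetFree P F' := by
  refine ⟨fun f => hF.false (OrderEmbedding.ofMapLEIff (fun p => ⟨(f p).1, h (f p).2⟩)
    fun p q => ?_)⟩
  exact f.le_iff_le

/-- Complementation reverses inclusion, so the mass above `A` becomes a mass below `Aᶜ` and the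
recursion for `downLubell` can be used. -/
lemma downLubell_image_compl {n : ℕ} (F : Finset (BoolLattice n)) (A : BoolLattice n) :
    downLubell (F.image compl) Aᶜ = lubell (upperFamily F A) := by
  classical
  have hF : F.filter (A ⊆ ·) = (upperFamily F A).map (upperEmb A).toEmbedding := by
    ext D
    simp only [Finset.mem_filter, Finset.mem_map, mem_upperFamily]
    constructor
    · rintro ⟨hD, hAD⟩
      obtain ⟨E, rfl⟩ := exists_upperEmb_eq hAD
      exact ⟨E, hD, rfl⟩
    · rintro ⟨E, hE, rfl⟩
      exact ⟨hE, Finset.subset_union_left⟩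
  rw [downLubell, Finset.sum_image compl_injective.injOn, lubell_eq_sum]
  simp_rw [Finset.compl_subset_compl]
  rw [← Finset.sum_filter, hF, Finset.sum_map]
  refine Finset.sum_congr rfl fun E _ => ?_
  have h1 : (upperEmb A E).card = A.card + E.card := card_upperEmb A E
  have h2 : (upperEmb A E).card ≤ n := by simpa using (upperEmb A E).card_le_univ
  rw [Finset.card_compl, Finset.card_compl, Fintype.card_fin]
  change ((n - A.card).choose (n - (upperEmb A E).card) : ℝ)⁻¹ = _
  rw [← Nat.choose_symm (show E.card ≤ n - A.card by omega), h1, Nat.sub_add_eq]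

lemma lubell_image_compl {n : ℕ} (F : Finset (BoolLattice n)) :
    lubell (F.image compl) = lubell F := by
  rw [lubell_eq_sum, lubell_eq_sum, Finset.sum_image compl_injective.injOn]
  refine Finset.sum_congr rfl fun A _ => ?_
  rw [Finset.card_compl, Fintype.card_fin, Nat.choose_symm (by simpa using A.card_le_univ)]

/-- Beyond its smallest member `A` of `F`, a random chain is uniform in the interval above `A`, and
chains that miss `F` contribute 0. -/
lemma lubell_le_of_forall_upperFamily {n : ℕ} {F : Finset (BoolLattice n)} {c : ℝ} (hc : 0 ≤ c)
    (h : ∀ A ∈ F, lubell (upperFamily F A) ≤ c) : lubell F ≤ c := by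
  rw [← lubell_image_compl, lubell_eq_downLubell_univ]
  refine downLubell_le_of_forall_mem hc (fun B hB => ?_) _
  obtain ⟨A, hA, rfl⟩ := Finset.mem_image.1 hB
  rw [downLubell_image_compl]
  exact h A hA

lemma card_le_lubell_mul {n : ℕ} (F : Finset (BoolLattice n)) :
    (F.card : ℝ) ≤ lubell F * (n.choose (n / 2) : ℝ) := by
  rw [lubell_eq_sum, Finset.sum_mul, Finset.card_eq_sum_ones, Nat.cast_sum]
  refine Finset.sum_le_sum fun A _ => ?_
  have hA : A.card ≤ n := by simpa using A.card_le_univ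
  have h0 : (0 : ℝ) < n.choose A.card := by exact_mod_cast Nat.choose_pos hA
  rw [inv_mul_eq_div, le_div_iff₀ h0, Nat.cast_one, one_mul]
  exact_mod_cast Nat.choose_le_middle _ _

lemma card_filter_large_le {n : ℕ} (m : ℕ) (hn : 1 ≤ n) (F : Finset (BoolLattice n)) :
    (F.filter fun A => ¬ A.card + m ≤ n).card ≤ m * n ^ m := by
  classical
  have hsub : (F.filter fun A => ¬ A.card + m ≤ n) ⊆ (Finset.range m).biUnion fun j =>
      (Finset.powersetCard j (Finset.univ : Finset (Fin n))).image compl := by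
    intro A hA
    have h1 := (Finset.mem_filter.1 hA).2
    have h2 : A.card ≤ n := by simpa using A.card_le_univ
    simp only [Finset.mem_biUnion, Finset.mem_range, Finset.mem_image, Finset.mem_powersetCard]
    exact ⟨n - A.card, by omega, Aᶜ, ⟨Finset.subset_univ _, by simp [Finset.card_compl]⟩,
      compl_compl A⟩
  refine (Finset.card_le_card hsub).trans ?_
  refine (Finset.card_biUnion_le_card_mul _ _ (n ^ m) fun j hj => ?_).trans (by simp)
  refine Finset.card_image_le.trans ?_
  rw [Finset.card_powersetCard, Finset.card_univ, Fintype.card_fin]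
  exact (Nat.choose_le_pow n j).trans (Nat.pow_le_pow_right hn (Finset.mem_range.1 hj).le)

/-- The mass hypothesis is only available in dimension at least `m`, so sets with fewer than `m`
missing points are counted separately; the error term is polynomial in `n`. -/
lemma turanLa_le {P : Type*} [PartialOrder P] {c : ℝ} (hc : 0 ≤ c) {m : ℕ}
    (h : ∀ k ≥ m, ∀ F : Finset (BoolLattice k), ∅ ∈ F ∧ IsPosetFree P F → lubell F ≤ c)
    {n : ℕ} (hn : 1 ≤ n) :
    (turanLa n P : ℝ) ≤ c * (n.choose (n / 2) : ℝ) + m * (n : ℝ) ^ m := by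
  classical
  have h0 : 0 ≤ c * (n.choose (n / 2) : ℝ) + m * (n : ℝ) ^ m := by positivity
  rw [← Nat.le_floor_iff h0, turanLa]
  refine Finset.sup_le fun F hF => Nat.le_floor ?_
  have hF' : IsPosetFree P F := (Finset.mem_filter.1 hF).2
  rw [← Finset.card_filter_add_card_filter_not (s := F) (fun A => A.card + m ≤ n)]
  push_cast
  refine add_le_add ?_ (by exact_mod_cast card_filter_large_le m hn F)
  refine (card_le_lubell_mul _).trans ?_
  gcongr
  refine lubell_le_of_forall_upperFamily hc fun A hA => ?_
  have hm := (Finset.mem_filter.1 hA).2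
  exact h _ (by omega) _
    ⟨empty_mem_upperFamily hA, (hF'.mono (Finset.filter_subset _ _)).upperFamily A⟩

lemma tendsto_pow_div_choose_half (m : ℕ) :
    Tendsto (fun n : ℕ => (m * (n : ℝ) ^ m) / (n.choose (n / 2) : ℝ)) atTop (𝓝 0) := by
  -- The extra power of `n` pays for `2 ^ n ≤ (n + 1) C(n, n/2) ≤ 2n C(n, n/2)`.
  have h1 : Tendsto (fun n : ℕ => (m : ℝ) * (2 * ((n : ℝ) ^ (m + 1) / 2 ^ n))) atTop (𝓝 0) := by
    have := ((tendsto_pow_const_div_const_pow_of_one_lt (m + 1) (r := (2 : ℝ))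
      (by norm_num)).const_mul 2).const_mul (m : ℝ)
    simpa using this
  refine squeeze_zero' (Eventually.of_forall fun n => by positivity) ?_ h1
  filter_upwards [eventually_ge_atTop 1] with n hn
  have h2 : (2 : ℝ) ^ n ≤ (n + 1) * (n.choose (n / 2) : ℝ) := by
    have : 2 ^ n ≤ (n + 1) * n.choose (n / 2) := by
      rw [← Nat.sum_range_choose]
      refine (Finset.sum_le_card_nsmul _ _ _ fun i _ => Nat.choose_le_middle i n).trans ?_
      simp
    exact_mod_cast this
  have h3 : (0 : ℝ) < n.choose (n / 2) := by
    exact_mod_cast Nat.choose_pos (Nat.div_le_self n 2)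
  have hn' : (1 : ℝ) ≤ n := by exact_mod_cast hn
  have h4 : (2 : ℝ) ^ n ≤ 2 * n * (n.choose (n / 2) : ℝ) := h2.trans (by gcongr; linarith)
  rw [div_le_iff₀ h3]
  calc (m : ℝ) * (n : ℝ) ^ m = m * ((n : ℝ) ^ m / 2 ^ n * 2 ^ n) := by
        rw [div_mul_cancel₀ _ (by positivity)]
    _ ≤ m * ((n : ℝ) ^ m / 2 ^ n * (2 * n * (n.choose (n / 2) : ℝ))) := by gcongr
    _ = _ := by ring

lemma turanThreshold_le_rhoStar {P : Type*} [PartialOrder P] (hP : 0 ≤ rhoStar P) :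
    turanThreshold P ≤ rhoStar P := by
  refine EReal.le_of_forall_lt_iff_le.1 fun c hc => ?_
  have hc0 : 0 ≤ c := by exact_mod_cast (hP.trans_lt hc).le
  obtain ⟨m, hm⟩ := eventually_atTop.1 (eventually_lt_of_limsup_lt hc)
  have hle : ∀ k ≥ m, ∀ F : Finset (BoolLattice k), ∅ ∈ F ∧ IsPosetFree P F → lubell F ≤ c := by
    intro k hk F hF
    have := (le_iSup₂ (f := fun (F : Finset (BoolLattice k)) (_ : ∅ ∈ F ∧ IsPosetFree P F) =>
      ((lubell F : ℝ) : EReal)) F hF).trans (hm k hk).le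
    exact_mod_cast this
  have hlim : Tendsto (fun n : ℕ =>
      ((c + (m * (n : ℝ) ^ m) / (n.choose (n / 2) : ℝ) : ℝ) : EReal)) atTop (𝓝 (c : EReal)) := by
    refine (continuous_coe_real_ereal.tendsto c).comp ?_
    simpa using (tendsto_pow_div_choose_half m).const_add c
  rw [← hlim.limsup_eq]
  refine limsup_le_limsup ?_
  filter_upwards [eventually_ge_atTop 1] with n hn
  have h3 : (0 : ℝ) < n.choose (n / 2) := by
    exact_mod_cast Nat.choose_pos (Nat.div_le_self n 2)
  rw [EReal.coe_le_coe_iff, div_le_iff₀ h3, add_mul, div_mul_cancel₀ _ h3.ne']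
  exact turanLa_le hc0 hle hn

lemma exists_tendsto_zero_turanLa_le {P : Type*} [PartialOrder P] {c : ℝ}
    (hc : turanThreshold P < (c : EReal)) :
    ∃ ε : ℕ → ℝ, Tendsto ε atTop (𝓝 0) ∧
      ∀ n : ℕ, (turanLa n P : ℝ) ≤ (c + ε n) * (n.choose (n / 2) : ℝ) := by
  -- The positive part of the excess is eventually zero, because the threshold is strictly below
  -- `c`.
  refine ⟨fun n => max 0 ((turanLa n P : ℝ) / (n.choose (n / 2) : ℝ) - c), ?_, fun n => ?_⟩
  · refine tendsto_const_nhds.congr' ?_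
    filter_upwards [eventually_lt_of_limsup_lt hc] with n hn
    have : (turanLa n P : ℝ) / (n.choose (n / 2) : ℝ) < c := by exact_mod_cast hn
    exact (max_eq_left (by linarith)).symm
  · have h3 : (0 : ℝ) < n.choose (n / 2) := by
      exact_mod_cast Nat.choose_pos (Nat.div_le_self n 2)
    rw [← div_le_iff₀ h3]
    linarith [le_max_right 0 ((turanLa n P : ℝ) / (n.choose (n / 2) : ℝ) - c)]

theorem mainTheorem6 :
    (((2.2818564 : ℝ) : EReal) < rhoStar (BoolLattice 2) ∧
      rhoStar (BoolLattice 2) < ((2.5823284 : ℝ) : EReal)) ∧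
    turanThreshold (BoolLattice 2) ≤ rhoStar (BoolLattice 2) ∧
    ∃ ε : ℕ → ℝ, Tendsto ε atTop (𝓝 0) ∧
      ∀ n : ℕ, (turanLa n (BoolLattice 2) : ℝ) ≤ (2.583 + ε n) * (n.choose (n / 2) : ℝ) := by
  have hpos : 0 ≤ rhoStar (BoolLattice 2) :=
    le_trans (by norm_cast; norm_num) lt_rhoStar_boolLattice_two.le
  have hle := turanThreshold_le_rhoStar hpos
  refine ⟨⟨lt_rhoStar_boolLattice_two, rhoStar_boolLattice_two_lt⟩, hle,
    exists_tendsto_zero_turanLa_le ((hle.trans_lt rhoStar_boolLattice_two_lt).trans ?_)⟩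
  norm_cast
  norm_num
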